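/- Posets are non-empty and given by their strict orders. Let $\mathcal P$ be the countable set of isomorphism classes of finite posets. For $Q,P\in\mathcal P$ let $t(Q,P)$ be the proportion of all maps $Q\to P$ that are poset homomorphisms (that is, $x<_Q y$ implies $\varphi(x)<_P\varphi(y)$). Identify $\mathcal P$ with its image under the injective map $P\mapsto\bigl((t(Q,P))_{Q\in\mathcal P},\,1/|P|\bigr)\in[0,1]^{\mathcal P}\times[0,1]$, let $\overline{\mathcal P}$ be its closure, and let $\mathcal P_\infty=\overline{\mathcal P}\setminus\mathcal P$ be the space of proper poset limits, with the subspace topology; $t(Q,\cdot)$ is extended by continuity to $\overline{\mathcal P}$. For a finite poset $Q$ let $n(Q)$ be the number of elements of $Q$ that are comparable to some other element of $Q$. **Theorem.** The space $\mathcal P_\infty$ is contractible, and in particular connected and simply connected. More precisely, there are a point $\Pi_E\in\mathcal P_\infty$, with $t(Q,\Pi_E)=1$ if no two elements of $Q$ are comparable and $t(Q,\Pi_E)=0$ otherwise, and a continuous map $\Psi:\mathcal P_\infty\times[0,1]\to\mathcal P_\infty$ with $\Psi(\Pi,0)=\Pi$ and $\Psi(\Pi,1)=\Pi_E$ for all $\Pi$,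 such that $\Pi_{(p)}:=\Psi(\Pi,1-p)$ is the following thinning of $\Pi$, for every $\Pi\in\mathcal P_\infty$ and $p\in[0,1]$. 1. $t(Q,\Pi_{(p)})=p^{\,n(Q)}\,t(Q,\Pi)$ for every finite poset $Q$ (with $0^0=1$). 2. Say that a random poset $R$ on $\mathbb N$ is a version of $P(\infty,\Pi)$ if $\mathbb P(Q\subset R)=t(Q,\Pi)$ for every finite poset $Q$ with ground set an initial segment of $\mathbb N$; this determines the distribution of $R$. Such an $R$ exists for every $\Pi$. If $R$ is a version of $P(\infty,\Pi)$ and each $i\in\mathbb N$ is, with probability $1-p$, independently of the other points and of $R$, made incomparable to everything, then the resulting random poset is a version of $P(\infty,\Pi_{(p)})$. 3. Let $(S,\mu)$ be a probability space with a partial order $\prec$ such that $\{(x,y):x\prec y\}$ is measurable in $S\times S$, and let $W:S\times S\to[0,1]$ be a measurable function such that $W(x,y)>0$ implies $x\prec y$, and $W(x,y)>0$, $W(y,z)>0$ imply $W(x,z)=1$. Suppose that $W$ represents $\Pi$, that is, $t(Q,\Pi)=\int_{S^{|Q|}}\prod_{i<_Qj}W(x_i,x_j)\,d\mu(x_1)\cdots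 d\mu(x_{|Q|})$ for every finite poset $Q$. Add to $S$ a new point $*$ of mass $1-p$, incomparable to everything, replace $\mu$ by $p\mu$ on $S$, and extend $W$ by $W(*,x)=W(x,*)=W(*,*)=0$. Then the extended kernel represents $\Pi_{(p)}$. -/

import Mathlib

open MeasureTheory ProbabilityTheory unitInterval

/-- A finite non-empty labelled poset with ground set `Fin n` (`n ≥ 1`), given by its strict
order relation. -/
structure FinPoset where
  /-- the number of elements -/
  n : ℕ
  pos : 0 < n
  /-- the strict order `<` -/
  lt : Fin n → Fin n → Prop
  irrefl : ∀ x, ¬ lt x x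
  trans : ∀ x y z, lt x y → lt y z → lt x z

/-- Isomorphism of finite posets. -/
instance FinPoset.isoSetoid : Setoid FinPoset where
  r P Q := Nonempty (P.lt ≃r Q.lt)
  iseqv :=
    { refl := fun P => ⟨RelIso.refl P.lt⟩
      symm := fun ⟨e⟩ => ⟨e.symm⟩
      trans := fun ⟨e⟩ ⟨f⟩ => ⟨e.trans f⟩ }

/-- The set of unlabelled finite posets, i.e. isomorphism classes of finite posets. -/
def UPoset : Type := Quotient FinPoset.isoSetoid

/-- The unlabelled poset underlying a labelled one. -/
def FinPoset.unlabel (P : FinPoset) : UPoset := Quotient.mk FinPoset.isoSetoid P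

theorem FinPoset.card_eq_of_equiv {P Q : FinPoset} (h : P ≈ Q) : P.n = Q.n := by
  obtain ⟨e⟩ := h
  simpa using Fintype.card_congr e.toEquiv

/-- The number of elements of an unlabelled finite poset. -/
def UPoset.size (P : UPoset) : ℕ :=
  Quotient.lift FinPoset.n (fun _ _ h => FinPoset.card_eq_of_equiv h) P

/-- `t(Q, P)` for labelled posets: the proportion of all maps `Q → P` which are poset
homomorphisms. -/
noncomputable def FinPoset.homDensity (Q P : FinPoset) : ℝ :=
  (Nat.card (Q.lt →r P.lt) : ℝ) / (Nat.card (Fin Q.n → Fin P.n) : ℝ)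

theorem FinPoset.homDensity_mem (Q P : FinPoset) : Q.homDensity P ∈ Set.Icc (0 : ℝ) 1 := by
  refine ⟨by unfold FinPoset.homDensity; positivity, ?_⟩
  refine div_le_one_of_le₀ ?_ (by positivity)
  exact_mod_cast Nat.card_le_card_of_injective (fun f : Q.lt →r P.lt => (f : Fin Q.n → Fin P.n))
    DFunLike.coe_injective

theorem FinPoset.homDensity_congr {Q P Q' P' : FinPoset} (hQ : Q ≈ Q') (hP : P ≈ P') :
    Q.homDensity P = Q'.homDensity P' := by
  have h1 := FinPoset.card_eq_of_equiv hQ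
  have h2 := FinPoset.card_eq_of_equiv hP
  obtain ⟨e⟩ := hQ
  obtain ⟨f⟩ := hP
  have h3 : Nat.card (Q.lt →r P.lt) = Nat.card (Q'.lt →r P'.lt) := by
    refine Nat.card_congr
      { toFun := fun g => (f.toRelEmbedding.toRelHom.comp g).comp e.symm.toRelEmbedding.toRelHom
        invFun := fun g => (f.symm.toRelEmbedding.toRelHom.comp g).comp e.toRelEmbedding.toRelHom
        left_inv := fun g => by ext x; simp
        right_inv := fun g => by ext x; simp }
  unfold FinPoset.homDensity
  rw [h3]
  simp only [Nat.card_eq_fintype_card, Fintype.card_pi_const, Fintype.card_fin, h1, h2]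

/-- `t(Q, P) ∈ [0,1]` for unlabelled finite posets. -/
noncomputable def UPoset.homDensity (Q P : UPoset) : I :=
  Quotient.lift₂ (fun Q P : FinPoset => (⟨Q.homDensity P, Q.homDensity_mem P⟩ : I))
    (fun _ _ _ _ hQ hP => Subtype.ext (FinPoset.homDensity_congr hQ hP)) Q P

/-- The embedding `P ↦ ((t(Q, P))_Q, 1/|P|)` of the set of unlabelled finite posets into the
compact metrizable space `[0,1]^𝒫 × [0,1]`. -/
noncomputable def UPoset.embed (P : UPoset) : (UPoset → I) × I :=
  (fun Q => Q.homDensity P,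
    ⟨(P.size : ℝ)⁻¹, by positivity, Nat.cast_inv_le_one P.size⟩)

/-- The set of poset limits: the closure of the set of finite posets. -/
noncomputable def posetLimits : Set ((UPoset → I) × I) := closure (Set.range UPoset.embed)

/-- The set of proper poset limits: the poset limits which are not finite posets. -/
noncomputable def properPosetLimits : Set ((UPoset → I) × I) :=
  posetLimits \ Set.range UPoset.embed

/-- The space of proper poset limits, with the subspace topology of `[0,1]^𝒫 × [0,1]`. -/
abbrev ProperPosetLimit : Type := properPosetLimits

/-- The functional `t(Q, ·)` extended by continuity to (proper) poset limits, i.e. the coordinate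
with index `Q`. -/
noncomputable def ProperPosetLimit.t (Q : FinPoset) (Γ : ProperPosetLimit) : ℝ :=
  ((Γ : (UPoset → I) × I).1 Q.unlabel : ℝ)

/-- The number of elements of `Q` that are comparable to at least one other element. -/
noncomputable def FinPoset.numComparable (Q : FinPoset) : ℕ :=
  Nat.card {x : Fin Q.n // ∃ y, Q.lt x y ∨ Q.lt y x}

/-- A kernel on an ordered probability space; the order `prec` on `S` is part of the data, and the
probability measure is a separate argument below. -/
structure PosetKernel (S : Type*) [MeasurableSpace S] where
  /-- the partial order on `S`, as a strict order -/
  prec : S → S → Prop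
  prec_irrefl : ∀ x, ¬ prec x x
  prec_trans : ∀ x y z, prec x y → prec y z → prec x z
  measurableSet_prec : MeasurableSet {z : S × S | prec z.1 z.2}
  /-- the kernel -/
  W : S → S → ℝ
  measurable_W : Measurable (fun z : S × S => W z.1 z.2)
  W_mem : ∀ x y, W x y ∈ Set.Icc (0 : ℝ) 1
  prec_of_pos : ∀ x y, 0 < W x y → prec x y
  eq_one_of_pos : ∀ x y z, 0 < W x y → 0 < W y z → W x z = 1

open Classical in
/-- The kernel `K` on `(S, μ)` represents the proper poset limit `Γ`:
`t(Q, Γ) = ∫ ∏_{i <_Q j} W(x_i, x_j) dμ(x_1) ⋯ dμ(x_|Q|)` for every finite poset `Q`. -/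
def PosetKernel.Represents {S : Type*} [MeasurableSpace S] (K : PosetKernel S) (μ : Measure S)
    (Γ : ProperPosetLimit) : Prop :=
  ∀ Q : FinPoset, Γ.t Q =
    ∫ x : Fin Q.n → S, (∏ i, ∏ j, if Q.lt i j then K.W (x i) (x j) else 1)
      ∂(Measure.pi fun _ => μ)

theorem measurableEmbedding_map_inl_inl (S : Type*) [MeasurableSpace S] :
    MeasurableEmbedding
      (Prod.map (Sum.inl : S → S ⊕ Unit) (Sum.inl : S → S ⊕ Unit)) := by
  have h : MeasurableEmbedding (Sum.inl : S → S ⊕ Unit) :=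
    ⟨Sum.inl_injective, measurable_inl, fun _ hs => measurableSet_inl_image.mpr hs⟩
  exact h.prodMap h

/-- The extension of a kernel on `S` to `S ∪ {*}`, with `*` incomparable to everything and the
kernel vanishing when one of its arguments is `*`. -/
def PosetKernel.addPoint {S : Type*} [MeasurableSpace S] (K : PosetKernel S) :
    PosetKernel (S ⊕ Unit) where
  prec
    | Sum.inl x, Sum.inl y => K.prec x y
    | _, _ => False
  prec_irrefl := by
    rintro (x | x)
    · exact K.prec_irrefl x
    · exact id
  prec_trans := by
    rintro (x | x) (y | y) (z | z) h1 h2 <;> first | exact h1.elim | exact h2.elim | skip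
    exact K.prec_trans x y z h1 h2
  measurableSet_prec := by
    have he := measurableEmbedding_map_inl_inl S
    convert he.measurableSet_image.mpr K.measurableSet_prec using 1
    ext ⟨x | x, y | y⟩ <;> simp
  W
    | Sum.inl x, Sum.inl y => K.W x y
    | _, _ => 0
  measurable_W := by
    have he := measurableEmbedding_map_inl_inl S
    convert he.measurable_extend K.measurable_W (measurable_const (a := (0 : ℝ))) using 1
    ext ⟨x | x, y | y⟩
    · exact (he.injective.extend_apply (fun z : S × S => K.W z.1 z.2) (fun _ => (0 : ℝ)) (x, y)).symm
    all_goals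
      rw [Function.extend_apply']
      rintro ⟨⟨a, b⟩, h⟩
      simp at h
  W_mem := by
    rintro (x | x) (y | y)
    · exact K.W_mem x y
    all_goals simp
  prec_of_pos := by
    rintro (x | x) (y | y) h
    · exact K.prec_of_pos x y h
    all_goals exact (lt_irrefl _ h).elim
  eq_one_of_pos := by
    rintro (x | x) (y | y) (z | z) h1 h2 <;>
      first | exact (lt_irrefl _ h1).elim | exact (lt_irrefl _ h2).elim | skip
    exact K.eq_one_of_pos x y z h1 h2

/-- The measure on `S ∪ {*}` with mass `1 - p` at `*` and equal to `p μ` on `S`. -/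
noncomputable def addPointMeasure {S : Type*} [MeasurableSpace S] (μ : Measure S) (p : I) :
    Measure (S ⊕ Unit) :=
  ENNReal.ofReal p • μ.map Sum.inl + ENNReal.ofReal (1 - p) • Measure.dirac (Sum.inr ())

/-- `R` is (a version of) the exchangeable random infinite poset `P(∞, Γ)` of the proper poset
limit `Γ`: a random poset on `ℕ` which contains every finite labelled poset `Q` with probability
`t(Q, Γ)`. This determines the distribution of `R`. -/
def IsInfinitePosetOf {Ω : Type*} [MeasurableSpace Ω] (P : Measure Ω) (R : Ω → ℕ → ℕ → Prop)
    (Γ : ProperPosetLimit) : Prop :=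
  Measurable R ∧ (∀ ω, IsStrictOrder ℕ (R ω)) ∧
    ∀ Q : FinPoset, P.real {ω | ∀ i j : Fin Q.n, Q.lt i j → R ω i j} = Γ.t Q

/-- `keep` is a family of independent events `keep i` of probability `p` each, jointly independent
of the random relation `R`. -/
def IsThinningOf {Ω : Type*} [MeasurableSpace Ω] (P : Measure Ω) (R : Ω → ℕ → ℕ → Prop)
    (keep : ℕ → Ω → Prop) (p : I) : Prop :=
  (∀ i, Measurable (keep i)) ∧ (∀ i, P.real {ω | keep i ω} = p) ∧ iIndepFun keep P ∧
    IndepFun (fun ω i => keep i ω) R P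

/-- The random relation obtained from `R` by making every `i` which is not kept incomparable to
everything. -/
def thinRel {Ω : Type*} (R : Ω → ℕ → ℕ → Prop) (keep : ℕ → Ω → Prop) : Ω → ℕ → ℕ → Prop :=
  fun ω i j => keep i ω ∧ keep j ω ∧ R ω i j

/-!
Thinning multiplies `t(Q, ·)` by `p ^ n(Q)` because a map into a thinned structure is a
homomorphism exactly when it is a homomorphism into the original structure and sends every
comparable element of `Q` to a kept point.  For a finite poset `P`, thinning is realised, in the
limit `b → ∞`, by `b`-fold blow-ups of `P` in which a fraction `p` of the copies of each point is
kept.  Since `x ↦ (p ^ n(Q) x_Q)_Q` is continuous, it therefore maps poset limits to poset limits,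
and it contracts the proper ones: a poset limit is proper exactly when its last coordinate is `0`,
there being finitely many posets of each size.

Random infinite posets exist by compactness: containing `Q` is a clopen condition on an order on
`ℕ`, so the vectors of containment probabilities of all random orders form a closed set, and this
set contains the densities of every finite poset `P` (pull back `<_P` along independent uniform
points).
-/

/-! ### Comparable elements -/

namespace FinPoset

/-- `x` is comparable to some other element of `Q`; these are the elements counted by
`numComparable`. -/
def IsComparable (Q : FinPoset) (x : Fin Q.n) : Prop := ∃ y, Q.lt x y ∨ Q.lt y x

theorem forall_lt_imp_and_iff {Q : FinPoset} {kept : Fin Q.n → Prop} :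
    (∀ i j, Q.lt i j → kept i ∧ kept j) ↔ ∀ i, Q.IsComparable i → kept i := by
  refine ⟨?_, fun h i j hij => ⟨h i ⟨j, .inl hij⟩, h j ⟨i, .inr hij⟩⟩⟩
  rintro h i ⟨j, hij | hji⟩
  exacts [(h i j hij).1, (h j i hji).2]

theorem numComparable_congr {P Q : FinPoset} (h : P ≈ Q) :
    P.numComparable = Q.numComparable := by
  obtain ⟨e⟩ := h
  exact Nat.card_congr (e.toEquiv.subtypeEquiv fun x => e.toEquiv.exists_congr fun y =>
    or_congr e.map_rel_iff.symm e.map_rel_iff.symm)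

theorem numComparable_eq_zero_iff {Q : FinPoset} :
    Q.numComparable = 0 ↔ ¬ ∃ x y, Q.lt x y := by
  rw [numComparable, Finite.card_eq_zero_iff, isEmpty_subtype]
  grind

open Classical in
theorem prod_ite_isComparable {M : Type*} [CommMonoid M] (Q : FinPoset) (c : M) :
    ∏ x, (if Q.IsComparable x then c else 1) = c ^ Q.numComparable := by
  rw [Finset.prod_ite, Finset.prod_const, Finset.prod_const_one, mul_one, numComparable,
    Nat.card_eq_fintype_card, Fintype.card_subtype]
  congr!

theorem measureReal_forall_isComparable {Ω : Type*} [MeasurableSpace Ω] {P : Measure Ω}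
    (Q : FinPoset) {keep : Fin Q.n → Ω → Prop} (hind : iIndepFun keep P) {p : ℝ}
    (hp : ∀ i, P.real {ω | keep i ω} = p) :
    P.real {ω | ∀ i, Q.IsComparable i → keep i ω} = p ^ Q.numComparable := by
  classical
  have := hind.isProbabilityMeasure
  have hmeas : ∀ i, MeasurableSet[MeasurableSpace.comap (keep i) ⊤]
      {ω | Q.IsComparable i → keep i ω} :=
    fun i => ⟨{b | Q.IsComparable i → b}, trivial, rfl⟩
  rw [Set.ofPred_forall, Measure.real, hind.meas_iInter hmeas, ENNReal.toReal_prod,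
    ← Q.prod_ite_isComparable p]
  refine Finset.prod_congr rfl fun i _ => ?_
  split_ifs with hi
  · simp only [hi, true_imp_iff]
    exact hp i
  · simp [hi]

end FinPoset

/-! ### Densities in kernels -/

section Kernel

variable {S T : Type*}

open Classical in
/-- The product of `W` over the pairs `i <_Q j`, whose integral is the density of `Q` in `W`. -/
noncomputable def FinPoset.kernelProd (Q : FinPoset) (W : S → S → ℝ) (x : Fin Q.n → S) : ℝ :=
  ∏ i, ∏ j, if Q.lt i j then W (x i) (x j) else 1

open Classical in
theorem FinPoset.kernelProd_ite (Q : FinPoset) (W : S → S → ℝ) (r : S → S → Prop)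
    [DecidableRel r] (x : Fin Q.n → S) :
    Q.kernelProd (fun y z => if r y z then W y z else 0) x =
      if ∀ i j, Q.lt i j → r (x i) (x j) then Q.kernelProd W x else 0 := by
  split_ifs with h
  · refine Finset.prod_congr rfl fun i _ => Finset.prod_congr rfl fun j _ => ?_
    exact ite_congr rfl (fun hij => if_pos (h i j hij)) fun _ => rfl
  · push Not at h
    obtain ⟨i, j, hij, hr⟩ := h
    exact Finset.prod_eq_zero (Finset.mem_univ i)
      (Finset.prod_eq_zero (Finset.mem_univ j) (by simp [hij, hr]))

open Classical in
/-- The thinning of the kernel `W` on `S × T`: a point `(x, y)` is kept if `y ∈ A`. -/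
noncomputable def thinKernel (W : S → S → ℝ) (A : Set T) (z w : S × T) : ℝ :=
  if z.2 ∈ A ∧ w.2 ∈ A then W z.1 w.1 else 0

theorem FinPoset.kernelProd_thinKernel (Q : FinPoset) (W : S → S → ℝ) (A : Set T)
    (x : Fin Q.n → S) (y : Fin Q.n → T) :
    Q.kernelProd (thinKernel W A) (fun i => (x i, y i)) =
      Q.kernelProd W x * {y | ∀ i, Q.IsComparable i → y i ∈ A}.indicator 1 y := by
  classical
  unfold thinKernel
  rw [Q.kernelProd_ite (fun z w : S × T => W z.1 w.1) (fun z w => z.2 ∈ A ∧ w.2 ∈ A)]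
  simp [FinPoset.forall_lt_imp_and_iff, FinPoset.kernelProd, Set.indicator_apply]

variable [MeasurableSpace S] [MeasurableSpace T]

/-- The density `t(Q, W)` of `Q` in a kernel `W` on `(S, μ)`. -/
noncomputable def FinPoset.kernelDensity (Q : FinPoset) (μ : Measure S) (W : S → S → ℝ) : ℝ :=
  ∫ x, Q.kernelProd W x ∂(Measure.pi fun _ => μ)

theorem FinPoset.measurable_kernelProd (Q : FinPoset) {W : S → S → ℝ}
    (hW : Measurable fun z : S × S => W z.1 z.2) : Measurable (Q.kernelProd W) := by
  classical
  refine Finset.measurable_prod _ fun i _ => Finset.measurable_prod _ fun j _ => ?_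
  split_ifs
  · exact hW.comp (by fun_prop : Measurable fun x : Fin Q.n → S => (x i, x j))
  · exact measurable_const

theorem FinPoset.kernelDensity_comp (Q : FinPoset) {μ : Measure S} {ν : Measure T}
    [SigmaFinite μ] [SigmaFinite ν] {f : S → T} (hf : MeasurePreserving f μ ν) {W : T → T → ℝ}
    (hW : Measurable fun z : T × T => W z.1 z.2) :
    Q.kernelDensity μ (fun x y => W (f x) (f y)) = Q.kernelDensity ν W := by
  have hpi := measurePreserving_pi (fun _ : Fin Q.n => μ) (fun _ => ν) fun _ => hf
  rw [kernelDensity, kernelDensity, ← hpi.map_eq, integral_map hpi.measurable.aemeasurable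
    (Q.measurable_kernelProd hW).aestronglyMeasurable]
  rfl

theorem FinPoset.kernelDensity_thinKernel (Q : FinPoset) (μ : Measure S) [SigmaFinite μ]
    (ν : Measure T) [IsProbabilityMeasure ν] (W : S → S → ℝ) {A : Set T} (hA : MeasurableSet A) :
    Q.kernelDensity (μ.prod ν) (thinKernel W A) =
      ν.real A ^ Q.numComparable * Q.kernelDensity μ W := by
  have hind : iIndepFun (fun (i : Fin Q.n) (y : Fin Q.n → T) => y i ∈ A)
      (Measure.pi fun _ => ν) :=
    iIndepFun_pi (X := fun _ y => y ∈ A) fun _ => hA.mem.aemeasurable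
  have hkept (i : Fin Q.n) : (Measure.pi fun _ => ν).real {y : Fin Q.n → T | y i ∈ A} =
      ν.real A :=
    (measurePreserving_eval (fun _ => ν) i).measureReal_preimage hA.nullMeasurableSet
  have hmeas : MeasurableSet {y : Fin Q.n → T | ∀ i, Q.IsComparable i → y i ∈ A} := by
    measurability
  have hsplit := (measurePreserving_arrowProdEquivProdArrow S T (Fin Q.n) (fun _ => μ)
    (fun _ => ν)).symm
  rw [kernelDensity, ← hsplit.integral_comp']
  calc ∫ z, Q.kernelProd (thinKernel W A) (fun i => (z.1 i, z.2 i))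
        ∂(Measure.pi fun _ => μ).prod (Measure.pi fun _ => ν)
    _ = Q.kernelDensity μ W *
          (Measure.pi fun _ => ν).real {y | ∀ i, Q.IsComparable i → y i ∈ A} := by
      simp only [kernelProd_thinKernel]
      rw [integral_prod_mul (Q.kernelProd W), integral_indicator_one hmeas, kernelDensity]
    _ = ν.real A ^ Q.numComparable * Q.kernelDensity μ W := by
      rw [Q.measureReal_forall_isComparable hind hkept, mul_comm]

end Kernel

/-! ### Thinned blow-ups of finite posets -/

theorem measurePreserving_uniformOn_univ_prod {α β γ : Type*} [Finite α] [Finite β]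
    [MeasurableSpace α] [MeasurableSpace β] [MeasurableSpace γ] [MeasurableSingletonClass α]
    [MeasurableSingletonClass β] [MeasurableSingletonClass γ] (e : α × β ≃ γ) :
    MeasurePreserving e ((uniformOn Set.univ).prod (uniformOn Set.univ))
      (uniformOn Set.univ) := by
  have := Fintype.ofFinite α
  have := Fintype.ofFinite β
  have := Fintype.ofEquiv _ e
  refine ⟨measurable_of_countable e, Measure.ext_of_singleton fun c => ?_⟩
  obtain ⟨⟨a, b⟩, rfl⟩ := e.surjective c
  rw [Measure.map_apply (measurable_of_countable e) (measurableSet_singleton _),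
    ← Set.image_singleton, e.preimage_image, ← Set.singleton_prod_singleton, Measure.prod_prod]
  simp [uniformOn_univ, ← Fintype.card_congr e, ENNReal.mul_inv]

theorem uniformOn_univ_real {Ω : Type*} [Finite Ω] [MeasurableSpace Ω]
    [MeasurableSingletonClass Ω] (s : Set Ω) :
    (uniformOn Set.univ).real s = s.ncard / Nat.card Ω := by
  have := Fintype.ofFinite Ω
  rw [Measure.real, uniformOn_univ, Measure.count_apply (Set.to_countable s).measurableSet,
    ENNReal.toReal_div, ← s.toFinite.cast_ncard_eq, Nat.card_eq_fintype_card]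
  rfl

namespace FinPoset

instance (P : FinPoset) : Nonempty (Fin P.n) := ⟨⟨0, P.pos⟩⟩

theorem homDensity_eq_measureReal (Q P : FinPoset) :
    Q.homDensity P = (Measure.pi fun _ => uniformOn Set.univ).real
      {f : Fin Q.n → Fin P.n | ∀ i j, Q.lt i j → P.lt (f i) (f j)} := by
  have homEquiv : (Q.lt →r P.lt) ≃ {f : Fin Q.n → Fin P.n | ∀ i j, Q.lt i j → P.lt (f i) (f j)} :=
    ⟨fun f => ⟨f, fun _ _ => f.map_rel⟩, fun f => ⟨f, fun {i j} => f.2 i j⟩,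
      fun _ => rfl, fun _ => rfl⟩
  rw [homDensity, Nat.card_congr homEquiv, ← uniformOn_pi, Set.pi_univ, uniformOn_univ_real]
  rfl

theorem homDensity_eq_one {Q : FinPoset} (h : ¬ ∃ x y, Q.lt x y) (P : FinPoset) :
    Q.homDensity P = 1 := by
  push Not at h
  simp [homDensity_eq_measureReal, h]

open Classical in
theorem homDensity_eq_kernelDensity (Q P : FinPoset) :
    Q.homDensity P =
      Q.kernelDensity (uniformOn Set.univ) fun x y => if P.lt x y then 1 else 0 := by
  simp only [homDensity_eq_measureReal, kernelDensity, Q.kernelProd_ite (fun _ _ => 1)]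
  rw [← integral_indicator_one (Set.to_countable _).measurableSet]
  congr with x
  simp [Set.indicator_apply, kernelProd]

/-- The poset obtained from `P` by replacing every element by `b` pairwise incomparable copies
and making all but the first `a` copies of each element incomparable to everything.  The `k`-th
copy of `x` is encoded as `x * b + k`. -/
def thinnedBlowUp (P : FinPoset) (a b : ℕ) (hb : 0 < b) : FinPoset where
  n := P.n * b
  pos := Nat.mul_pos P.pos hb
  lt x y := ((finProdFinEquiv.symm x).2 < a ∧ (finProdFinEquiv.symm y).2 < a) ∧
    P.lt (finProdFinEquiv.symm x).1 (finProdFinEquiv.symm y).1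
  irrefl _ h := P.irrefl _ h.2
  trans _ _ _ h h' := ⟨⟨h.1.1, h'.1.2⟩, P.trans _ _ _ h.2 h'.2⟩

theorem homDensity_thinnedBlowUp (Q P : FinPoset) {a b : ℕ} (hb : 0 < b) (hab : a ≤ b) :
    Q.homDensity (P.thinnedBlowUp a b hb) =
      ((a : ℝ) / b) ^ Q.numComparable * Q.homDensity P := by
  classical
  have : Nonempty (Fin b) := ⟨⟨0, hb⟩⟩
  have hkept : (uniformOn Set.univ : Measure (Fin b)).real {k | k < a} = a / b := by
    rw [uniformOn_univ_real, Set.ncard_eq_toFinset_card']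
    simp [Fin.card_filter_val_lt, hab]
  have hcopies : Q.homDensity (P.thinnedBlowUp a b hb) =
      Q.kernelDensity ((uniformOn Set.univ).prod (uniformOn Set.univ))
        (thinKernel (fun x y => if P.lt x y then 1 else 0) {k : Fin b | k < a}) := by
    rw [homDensity_eq_kernelDensity]
    refine (Q.kernelDensity_comp (measurePreserving_uniformOn_univ_prod finProdFinEquiv)
      (measurable_of_countable _)).symm.trans ?_
    congr with x y
    simp only [thinKernel, thinnedBlowUp, ← ite_and]
    simp only [Equiv.symm_apply_apply, Set.mem_ofPred_eq]
  rw [hcopies, Q.kernelDensity_thinKernel _ _ _ (Set.to_countable _).measurableSet, hkept,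
    ← homDensity_eq_kernelDensity]

end FinPoset

/-! ### Thinning of poset limits -/

namespace UPoset

/-- The number of elements of an unlabelled poset that are comparable to another element. -/
noncomputable def numComparable (Q : UPoset) : ℕ :=
  Quotient.lift FinPoset.numComparable (fun _ _ => FinPoset.numComparable_congr) Q

theorem size_pos (P : UPoset) : 0 < P.size := by
  obtain ⟨P⟩ := P
  exact P.pos

theorem finite_setOf_size_le (N : ℕ) : {P : UPoset | P.size ≤ N}.Finite := by
  refine (Set.finite_range fun s : Σ k : Fin (N + 1), {r : Fin k → Fin k → Prop //
    0 < k.1 ∧ (∀ x, ¬ r x x) ∧ ∀ x y z, r x y → r y z → r x z} =>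
      FinPoset.unlabel ⟨s.1, s.2.2.1, s.2.1, s.2.2.2.1, s.2.2.2.2⟩).subset ?_
  rintro ⟨P⟩ hP
  exact ⟨⟨⟨P.n, Nat.lt_succ_of_le hP⟩, P.lt, P.pos, P.irrefl, P.trans⟩, rfl⟩

end UPoset

theorem mem_closure_image_compl_of_finite {ι X : Type*} [TopologicalSpace X] [T1Space X]
    {f : ι → X} {x : X} (hx : x ∈ closure (Set.range f)) {F : Set ι} (hF : F.Finite)
    (hxF : x ∉ f '' F) : x ∈ closure (f '' Fᶜ) := by
  rw [← Set.image_univ, ← Set.union_compl_self F, Set.image_union, closure_union,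
    (hF.image f).isClosed.closure_eq] at hx
  exact hx.resolve_left hxF

theorem posetLimits_subset {C : Set ((UPoset → I) × I)} (hC : IsClosed C)
    (h : ∀ P : FinPoset, P.unlabel.embed ∈ C) : posetLimits ⊆ C := by
  refine closure_minimal ?_ hC
  rintro _ ⟨⟨P⟩, rfl⟩
  exact h P

theorem mem_properPosetLimits_iff {x : (UPoset → I) × I} :
    x ∈ properPosetLimits ↔ x ∈ posetLimits ∧ x.2 = 0 := by
  refine and_congr_right fun hx => ⟨fun hproper => ?_, ?_⟩
  · have hle (N : ℕ) : (x.2 : ℝ) ≤ 1 / (N + 1) := by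
      have hlarge := mem_closure_image_compl_of_finite hx (UPoset.finite_setOf_size_le N)
        fun h => hproper (Set.image_subset_range _ _ h)
      have hclosed : IsClosed {y : (UPoset → I) × I | (y.2 : ℝ) ≤ 1 / (N + 1)} :=
        isClosed_le (by fun_prop) continuous_const
      refine closure_minimal ?_ hclosed hlarge
      rintro _ ⟨P, hP, rfl⟩
      have hsize : N + 1 ≤ P.size := by simpa using hP
      change (P.size : ℝ)⁻¹ ≤ 1 / (N + 1)
      rw [one_div]
      exact inv_anti₀ N.cast_add_one_pos (by exact_mod_cast hsize)
    exact Subtype.ext <| le_antisymm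
      (ge_of_tendsto' tendsto_one_div_add_atTop_nhds_zero_nat hle) x.2.2.1
  · rintro hx ⟨P, rfl⟩
    have : (P.size : ℝ)⁻¹ = 0 := congrArg Subtype.val hx
    simp [P.size_pos.ne'] at this

/-- The vector of densities of the thinning: `t(Q, ·)` is multiplied by `p ^ n(Q)`, and the
coordinate `1 / |P|` is replaced by `0`, its value at proper poset limits. -/
noncomputable def thinDensities (x : (UPoset → I) × I) (p : I) : (UPoset → I) × I :=
  (fun Q => p ^ Q.numComparable * x.1 Q, 0)

theorem continuous_thinDensities :
    Continuous fun z : ((UPoset → I) × I) × I => thinDensities z.1 z.2 := by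
  unfold thinDensities
  fun_prop

theorem thinDensities_embed_mem (P : FinPoset) (p : I) :
    thinDensities P.unlabel.embed p ∈ posetLimits := by
  have hle (b : ℕ) : ⌊(p : ℝ) * (b + 1 : ℕ)⌋₊ ≤ b + 1 :=
    Nat.floor_le_of_le (mul_le_of_le_one_left (by positivity) p.2.2)
  have hratio : Filter.Tendsto (fun b : ℕ => (⌊(p : ℝ) * (b + 1 : ℕ)⌋₊ : ℝ) / (b + 1 : ℕ))
      Filter.atTop (nhds p) :=
    ((tendsto_nat_floor_mul_div_atTop p.2.1).comp tendsto_natCast_atTop_atTop).comp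
      (Filter.tendsto_add_atTop_nat 1)
  refine mem_closure_of_tendsto (b := Filter.atTop) (f := fun b : ℕ =>
    (P.thinnedBlowUp ⌊(p : ℝ) * (b + 1 : ℕ)⌋₊ (b + 1) b.succ_pos).unlabel.embed) ?_
    (.of_forall fun b => Set.mem_range_self _)
  refine (tendsto_pi_nhds.2 ?_).prodMk_nhds (tendsto_subtype_rng.2 ?_)
  · rintro ⟨Q⟩
    have hdensity := (hratio.pow Q.numComparable).mul_const (Q.homDensity P)
    simp_rw [← FinPoset.homDensity_thinnedBlowUp Q P (Nat.succ_pos _) (hle _)] at hdensity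
    exact tendsto_subtype_rng.2 hdensity
  · change Filter.Tendsto (fun b : ℕ => ((P.n * (b + 1) : ℕ) : ℝ)⁻¹) _ (nhds 0)
    exact tendsto_inv_atTop_zero.comp <| tendsto_natCast_atTop_atTop.comp <|
      (Filter.tendsto_add_atTop_nat 1).const_mul_atTop' P.pos

theorem thinDensities_mem_posetLimits {x : (UPoset → I) × I} (hx : x ∈ posetLimits) (p : I) :
    thinDensities x p ∈ posetLimits := by
  have hcont : Continuous fun x => thinDensities x p :=
    continuous_thinDensities.comp (.prodMk_left p)
  exact posetLimits_subset (isClosed_closure.preimage hcont) (thinDensities_embed_mem · p) hx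

theorem thinDensities_mem_properPosetLimits {x : (UPoset → I) × I} (hx : x ∈ posetLimits)
    (p : I) : thinDensities x p ∈ properPosetLimits :=
  mem_properPosetLimits_iff.2 ⟨thinDensities_mem_posetLimits hx p, rfl⟩

theorem thinDensities_zero {x : (UPoset → I) × I} (hx : x ∈ posetLimits) :
    thinDensities x 0 = (fun Q => 0 ^ Q.numComparable, 0) := by
  refine Prod.ext (funext fun Q => ?_) rfl
  by_cases hQ : Q.numComparable = 0
  · have hone : x.1 Q = 1 := by
      refine posetLimits_subset (C := {x | x.1 Q = 1}) (isClosed_eq (by fun_prop) continuous_const)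
        (fun P => ?_) hx
      obtain ⟨Q⟩ := Q
      exact Subtype.ext (FinPoset.homDensity_eq_one (FinPoset.numComparable_eq_zero_iff.1 hQ) P)
    simp [thinDensities, hQ, hone]
  · simp [thinDensities, hQ]

namespace ProperPosetLimit

/-- The thinning `Γ_(p)` of a proper poset limit. -/
noncomputable def thin (Γ : ProperPosetLimit) (p : I) : ProperPosetLimit :=
  ⟨thinDensities Γ p, thinDensities_mem_properPosetLimits Γ.2.1 p⟩

theorem t_thin (Γ : ProperPosetLimit) (p : I) (Q : FinPoset) :
    (Γ.thin p).t Q = (p : ℝ) ^ Q.numComparable * Γ.t Q := rfl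

theorem continuous_thin : Continuous fun z : ProperPosetLimit × I => z.1.thin z.2 :=
  Continuous.subtype_mk (continuous_thinDensities.comp
    (continuous_subtype_val.prodMap continuous_id)) _

theorem thin_one (Γ : ProperPosetLimit) : Γ.thin 1 = Γ :=
  Subtype.ext <| Prod.ext (funext fun Q => by simp [thin, thinDensities])
    (mem_properPosetLimits_iff.1 Γ.2).2.symm

/-- The limit `Π_E` in which almost surely no two points are comparable. -/
noncomputable def edgeless : ProperPosetLimit :=
  ⟨(fun Q => 0 ^ Q.numComparable, 0), by
    have hx := subset_closure (Set.mem_range_self (f := UPoset.embed)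
      (FinPoset.unlabel ⟨1, one_pos, fun _ _ => False, fun _ => id, fun _ _ _ => False.elim⟩))
    rw [← thinDensities_zero hx]
    exact thinDensities_mem_properPosetLimits hx 0⟩

theorem t_edgeless (Q : FinPoset) : edgeless.t Q = 0 ^ Q.numComparable := rfl

theorem thin_zero (Γ : ProperPosetLimit) : Γ.thin 0 = edgeless :=
  Subtype.ext (thinDensities_zero Γ.2.1)

/-- The contraction `(p, Γ) ↦ Γ_(1 - p)` of the space of proper poset limits. -/
noncomputable def thinHomotopy : (ContinuousMap.id ProperPosetLimit).Homotopy
    (ContinuousMap.const ProperPosetLimit edgeless) where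
  toFun z := z.2.thin (σ z.1)
  continuous_toFun := continuous_thin.comp
    (continuous_snd.prodMk (unitInterval.continuous_symm.comp continuous_fst))
  map_zero_left Γ := by simp [thin_one]
  map_one_left Γ := by simp [thin_zero]

theorem thinHomotopy_symm_apply (p : I) (Γ : ProperPosetLimit) :
    thinHomotopy (σ p, Γ) = Γ.thin p := by
  change Γ.thin (σ (σ p)) = Γ.thin p
  rw [unitInterval.symm_symm]

instance : ContractibleSpace ProperPosetLimit :=
  (contractible_iff_id_nullhomotopic _).2 ⟨edgeless, ⟨thinHomotopy⟩⟩

end ProperPosetLimit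

/-! ### Random infinite posets -/

/-- The space of strict orders on `ℕ`, as a subspace of a product of two-point spaces. -/
def NatOrder : Set (ℕ → ℕ → Bool) :=
  {r | (∀ i, r i i = false) ∧ ∀ i j k, r i j = true → r j k = true → r i k = true}

namespace NatOrder

theorem isClosed : IsClosed NatOrder := by
  have hclopen (i j : ℕ) (b : Bool) : IsClopen {r : ℕ → ℕ → Bool | r i j = b} :=
    (isClopen_discrete {b}).preimage (continuous_apply_apply i j)
  simp only [NatOrder, Set.ofPred_and, Set.ofPred_forall]
  exact (isClosed_iInter fun i => (hclopen i i false).1).inter <|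
    isClosed_iInter fun i => isClosed_iInter fun j => isClosed_iInter fun k =>
      isClosed_imp (hclopen i j true).2 (isClosed_imp (hclopen j k true).2 (hclopen i k true).1)

instance : CompactSpace NatOrder := isCompact_iff_compactSpace.mp isClosed.isCompact

/-- The set of strict orders on `ℕ` which contain `Q`. -/
def containing (Q : FinPoset) : Set NatOrder := {r | ∀ i j : Fin Q.n, Q.lt i j → r.1 i j = true}

theorem isClopen_containing (Q : FinPoset) : IsClopen (containing Q) := by
  simp only [containing, Set.ofPred_forall]
  exact isClopen_iInter_of_finite fun i => isClopen_iInter_of_finite fun j =>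
    isClopen_iInter_of_finite fun _ => (isClopen_discrete {true}).preimage
      ((continuous_apply_apply (i : ℕ) (j : ℕ)).comp continuous_subtype_val)

open Classical in
/-- The order on `ℕ` pulled back from a finite poset along a map. -/
noncomputable def pullback (P : FinPoset) (x : ℕ → Fin P.n) : NatOrder :=
  ⟨fun i j => decide (P.lt (x i) (x j)), by simp [P.irrefl],
    by simpa using fun i j k => P.trans (x i) (x j) (x k)⟩

theorem measurable_pullback (P : FinPoset) : Measurable (pullback P) := by
  classical
  refine Measurable.subtype_mk (measurable_pi_iff.2 fun i => measurable_pi_iff.2 fun j => ?_)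
  exact (measurable_of_countable fun y : Fin P.n × Fin P.n => decide (P.lt y.1 y.2)).comp
    (by fun_prop : Measurable fun x : ℕ → Fin P.n => (x i, x j))

/-- The random order on `ℕ` obtained by sampling independent uniform points of a finite poset. -/
noncomputable def sample (P : FinPoset) : ProbabilityMeasure NatOrder :=
  ⟨(Measure.infinitePi fun _ => uniformOn Set.univ).map (pullback P),
    Measure.isProbabilityMeasure_map (measurable_pullback P).aemeasurable⟩

theorem sample_containing (Q P : FinPoset) :
    (sample P : Measure NatOrder).real (containing Q) = Q.homDensity P := by
  have hpoints : (Measure.infinitePi fun _ : ℕ => uniformOn Set.univ).map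
      (fun (x : ℕ → Fin P.n) (i : Fin Q.n) => x i) = Measure.pi fun _ => uniformOn Set.univ := by
    rw [Measure.map_infinitePi_infinitePi_of_inj Fin.val_injective, Measure.infinitePi_eq_pi]
  have hpre : pullback P ⁻¹' containing Q = (fun x (i : Fin Q.n) => x i) ⁻¹'
      {f : Fin Q.n → Fin P.n | ∀ i j, Q.lt i j → P.lt (f i) (f j)} := by
    ext x
    simp [containing, pullback]
  change ((Measure.infinitePi fun _ => uniformOn Set.univ).map (pullback P)).real _ = _
  rw [map_measureReal_apply (measurable_pullback P) (isClopen_containing Q).isOpen.measurableSet,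
    hpre, ← map_measureReal_apply (by fun_prop) (Set.to_countable _).measurableSet, hpoints,
    FinPoset.homDensity_eq_measureReal]

theorem continuous_measureReal_containing (Q : FinPoset) :
    Continuous fun μ : ProbabilityMeasure NatOrder =>
      (μ : Measure NatOrder).real (containing Q) :=
  continuous_iff_continuousAt.2 fun _ => (NNReal.continuous_coe.tendsto _).comp <|
    ProbabilityMeasure.tendsto_measure_of_isClopen_of_tendsto Filter.tendsto_id
      (isClopen_containing Q)

theorem exists_probabilityMeasure_containing_eq {x : (UPoset → I) × I} (hx : x ∈ posetLimits) :
    ∃ μ : ProbabilityMeasure NatOrder, ∀ Q : FinPoset,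
      (μ : Measure NatOrder).real (containing Q) = x.1 Q.unlabel := by
  let probs : ProbabilityMeasure NatOrder → FinPoset → ℝ :=
    fun μ Q => (μ : Measure NatOrder).real (containing Q)
  let densities : (UPoset → I) × I → FinPoset → ℝ := fun x Q => x.1 Q.unlabel
  have hprobs : IsCompact (Set.range probs) :=
    isCompact_range (continuous_pi continuous_measureReal_containing)
  have hclosed : IsClosed (densities ⁻¹' Set.range probs) :=
    hprobs.isClosed.preimage (by fun_prop)
  obtain ⟨μ, hμ⟩ := posetLimits_subset hclosed
    (fun P => ⟨sample P, funext fun Q => sample_containing Q P⟩) hx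
  exact ⟨μ, congrFun hμ⟩

end NatOrder

theorem ProperPosetLimit.exists_isInfinitePosetOf (Γ : ProperPosetLimit) :
    ∃ (Ω : Type) (_ : MeasurableSpace Ω) (P : Measure Ω) (_ : IsProbabilityMeasure P)
      (R : Ω → ℕ → ℕ → Prop), IsInfinitePosetOf P R Γ := by
  obtain ⟨μ, hμ⟩ := NatOrder.exists_probabilityMeasure_containing_eq Γ.2.1
  refine ⟨NatOrder, inferInstance, μ, inferInstance, fun r i j => r.1 i j = true, ?_, ?_, hμ⟩
  · refine measurable_pi_iff.2 fun i => measurable_pi_iff.2 fun j => ?_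
    exact (measurable_of_countable fun b : Bool => b = true).comp <|
      (measurable_pi_apply j).comp <| (measurable_pi_apply i).comp measurable_subtype_coe
  · intro r
    exact { irrefl := fun i h => by simp [r.2.1 i] at h, trans := r.2.2 }

section ThinRel

variable {Ω : Type*} {R : Ω → ℕ → ℕ → Prop} {keep : ℕ → Ω → Prop}

theorem isStrictOrder_thinRel {ω : Ω} (h : IsStrictOrder ℕ (R ω)) :
    IsStrictOrder ℕ (thinRel R keep ω) where
  irrefl i hi := h.irrefl i hi.2.2
  trans _ _ _ hij hjk := ⟨hij.1, hjk.2.1, h.trans _ _ _ hij.2.2 hjk.2.2⟩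

theorem FinPoset.setOf_forall_lt_thinRel (Q : FinPoset) :
    {ω | ∀ i j : Fin Q.n, Q.lt i j → thinRel R keep ω i j} =
      {ω | ∀ i : Fin Q.n, Q.IsComparable i → keep i ω} ∩
        {ω | ∀ i j : Fin Q.n, Q.lt i j → R ω i j} := by
  ext ω
  simp only [Set.mem_inter_iff, Set.mem_ofPred_eq, ← FinPoset.forall_lt_imp_and_iff,
    ← forall_and, thinRel, and_assoc]

variable [MeasurableSpace Ω]

theorem measurable_thinRel (hR : Measurable R) (hkeep : ∀ i, Measurable (keep i)) :
    Measurable (thinRel R keep) :=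
  measurable_pi_iff.2 fun i => measurable_pi_iff.2 fun j =>
    (hkeep i).and ((hkeep j).and (measurable_pi_iff.1 (measurable_pi_iff.1 hR i) j))

theorem FinPoset.measureReal_forall_lt_thinRel (Q : FinPoset) {P : Measure Ω} {p : I}
    (hkeep : IsThinningOf P R keep p) :
    P.real {ω | ∀ i j : Fin Q.n, Q.lt i j → thinRel R keep ω i j} =
      (p : ℝ) ^ Q.numComparable * P.real {ω | ∀ i j : Fin Q.n, Q.lt i j → R ω i j} := by
  obtain ⟨-, hprob, hindep, hindepR⟩ := hkeep
  have hkept : MeasurableSet {k : ℕ → Prop | ∀ i : Fin Q.n, Q.IsComparable i → k i} := by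
    measurability
  have hcontains : MeasurableSet {r : ℕ → ℕ → Prop | ∀ i j : Fin Q.n, Q.lt i j → r i j} := by
    measurability
  rw [Q.setOf_forall_lt_thinRel,
    ← Q.measureReal_forall_isComparable (hindep.precomp Fin.val_injective) fun i => hprob i,
    Measure.real, Measure.real, Measure.real, ← ENNReal.toReal_mul]
  exact congrArg _ (hindepR.measure_inter_preimage_eq_mul _ _ hkept hcontains)

theorem IsInfinitePosetOf.thin {P : Measure Ω} {Γ : ProperPosetLimit} {p : I}
    (hR : IsInfinitePosetOf P R Γ) (hkeep : IsThinningOf P R keep p) :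
    IsInfinitePosetOf P (thinRel R keep) (Γ.thin p) := by
  obtain ⟨hmeas, horder, hprob⟩ := hR
  refine ⟨measurable_thinRel hmeas hkeep.1, fun ω => isStrictOrder_thinRel (horder ω), fun Q => ?_⟩
  rw [Q.measureReal_forall_lt_thinRel hkeep, hprob, Γ.t_thin]

end ThinRel

/-! ### Thinning of kernels -/

section AddPoint

variable {S : Type*}

/-- The map which keeps a point of `S` if the coin shows `true`, and sends it to the extra point
otherwise. -/
def keepOrDrop (z : S × Bool) : S ⊕ Unit := if z.2 then Sum.inl z.1 else Sum.inr ()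

variable [MeasurableSpace S]

theorem PosetKernel.addPoint_W_keepOrDrop (K : PosetKernel S) (z w : S × Bool) :
    K.addPoint.W (keepOrDrop z) (keepOrDrop w) = thinKernel K.W {true} z w := by
  obtain ⟨x, _ | _⟩ := z <;> obtain ⟨y, _ | _⟩ := w <;>
    simp [keepOrDrop, thinKernel, PosetKernel.addPoint]

theorem measurePreserving_keepOrDrop (μ : Measure S) [IsProbabilityMeasure μ] (p : I) :
    MeasurePreserving keepOrDrop (μ.prod Ber(true, false, p)) (addPointMeasure μ p) := by
  have hm : Measurable (keepOrDrop : S × Bool → S ⊕ Unit) :=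
    .ite (measurable_snd (measurableSet_singleton true))
      (measurable_inl.comp measurable_fst) measurable_const
  have hkeep : (keepOrDrop ∘ fun x : S => (x, true)) = Sum.inl := rfl
  have hdrop : (keepOrDrop ∘ fun x : S => (x, false)) = fun _ => Sum.inr () := rfl
  refine ⟨hm, ?_⟩
  rw [bernoulliMeasure_def, Measure.prod_add, Measure.prod_smul_right, Measure.prod_smul_right,
    Measure.prod_dirac, Measure.prod_dirac, Measure.map_add _ _ hm, Measure.map_smul,
    Measure.map_smul, Measure.map_map hm (by fun_prop), Measure.map_map hm (by fun_prop),
    hkeep, hdrop, Measure.map_const, measure_univ, one_smul, addPointMeasure,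
    ENNReal.ofReal_eq_coe_nnreal p.2.1, ENNReal.ofReal_eq_coe_nnreal (sub_nonneg.2 p.2.2)]
  rfl

theorem PosetKernel.Represents.addPoint {K : PosetKernel S} {μ : Measure S}
    [IsProbabilityMeasure μ] {Γ : ProperPosetLimit} (h : K.Represents μ Γ) (p : I) :
    K.addPoint.Represents (addPointMeasure μ p) (Γ.thin p) := by
  intro Q
  have hmp := measurePreserving_keepOrDrop μ p
  have : IsProbabilityMeasure (addPointMeasure μ p) :=
    hmp.map_eq ▸ Measure.isProbabilityMeasure_map hmp.measurable.aemeasurable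
  calc (Γ.thin p).t Q
    _ = Ber(true, false, p).real {true} ^ Q.numComparable * Q.kernelDensity μ K.W := by
      rw [bernoulliMeasure_real_apply_of_mem_of_notMem p (measurableSet_singleton true) rfl
        Bool.false_ne_true, Γ.t_thin, h Q]
      rfl
    _ = Q.kernelDensity (addPointMeasure μ p) K.addPoint.W := by
      rw [← Q.kernelDensity_comp hmp K.addPoint.measurable_W,
        ← Q.kernelDensity_thinKernel μ _ K.W (measurableSet_singleton true)]
      simp only [PosetKernel.addPoint_W_keepOrDrop]

end AddPoint

theorem theorem11p1 :
    ContractibleSpace ProperPosetLimit ∧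
    ConnectedSpace ProperPosetLimit ∧
    SimplyConnectedSpace ProperPosetLimit ∧
    ∃ (Γ₀ : ProperPosetLimit)
      (Ψ : (ContinuousMap.id ProperPosetLimit).Homotopy
        (ContinuousMap.const ProperPosetLimit Γ₀)),
      -- the homotopy at time `1 - p` multiplies `t(Q, ·)` by `p ^ n(Q)`
      (∀ (Γ : ProperPosetLimit) (p : I) (Q : FinPoset),
        (Ψ (σ p, Γ)).t Q = (p : ℝ) ^ Q.numComparable * Γ.t Q) ∧
      -- it thins the random infinite poset of `Γ`
      (∀ Γ : ProperPosetLimit, ∃ (Ω : Type) (_ : MeasurableSpace Ω) (P : Measure Ω)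
        (_ : IsProbabilityMeasure P) (R : Ω → ℕ → ℕ → Prop), IsInfinitePosetOf P R Γ) ∧
      (∀ (Γ : ProperPosetLimit) (p : I) (Ω : Type*) [MeasurableSpace Ω] (P : Measure Ω)
        [IsProbabilityMeasure P] (R : Ω → ℕ → ℕ → Prop) (keep : ℕ → Ω → Prop),
        IsInfinitePosetOf P R Γ → IsThinningOf P R keep p →
          IsInfinitePosetOf P (thinRel R keep) (Ψ (σ p, Γ))) ∧
      -- it thins every kernel representing `Γ`
      (∀ (Γ : ProperPosetLimit) (p : I) (S : Type*) [MeasurableSpace S] (μ : Measure S)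
        [IsProbabilityMeasure μ] (K : PosetKernel S),
        K.Represents μ Γ → K.addPoint.Represents (addPointMeasure μ p) (Ψ (σ p, Γ))) ∧
      -- the end point of the homotopy
      (∀ Q : FinPoset, ((∃ x y, Q.lt x y) → Γ₀.t Q = 0) ∧ ((¬ ∃ x y, Q.lt x y) → Γ₀.t Q = 1)) := by
  refine ⟨inferInstance, inferInstance, inferInstance, ProperPosetLimit.edgeless,
    ProperPosetLimit.thinHomotopy, fun Γ p Q => ?_, fun Γ => Γ.exists_isInfinitePosetOf,
    fun Γ p Ω _ P _ R keep hR hkeep => ?_,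
    fun Γ p S _ μ _ K hK => ?_, fun Q => ⟨fun h => ?_, fun h => ?_⟩⟩
  · rw [ProperPosetLimit.thinHomotopy_symm_apply, Γ.t_thin]
  · exact ProperPosetLimit.thinHomotopy_symm_apply p Γ ▸ hR.thin hkeep
  · exact ProperPosetLimit.thinHomotopy_symm_apply p Γ ▸ hK.addPoint p
  · rw [ProperPosetLimit.t_edgeless, zero_pow fun h0 => FinPoset.numComparable_eq_zero_iff.1 h0 h]
  · rw [ProperPosetLimit.t_edgeless, FinPoset.numComparable_eq_zero_iff.2 h, pow_zero]
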